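/- Let $m$ be an odd positive integer, let $q=2^m$, and let $\mathcal{O}=\{(\xi,\xi^2,1)\mid \xi\in\mathbf{F}_q\}\cup\{(0,1,0)\}$, a nonsingular conic in $\mathrm{PG}(2,q)$. Let $\mathcal{E}$ be the set of exterior lines, i.e. the lines containing no point of $\mathcal{O}$; each of them is $(1,x,y)^\perp=\{(a_0,a_1,a_2) \mid a_0+a_1x+a_2y=0\}$ for a unique pair $x,y\in\mathbf{F}_q$. For $\ell=(1,x,y)^\perp$ and $\ell'=(1,z,u)^\perp$ put $$\hat\rho(\ell,\ell')=x^2u^2+y^2z^2+(x+z)(y+u).$$ Let $\mathbf{T}_0^*$ be the set of nonzero $x\in\mathbf{F}_q$ with $\mathrm{Tr}_{\mathbf{F}_q/\mathbf{F}_2}(x)=0$, let $\Gamma_0$ be the diagonal of $\mathcal{E}\times\mathcal{E}$, and for $a\in\mathbf{T}_0^*$ let $\Gamma_a=\{(\ell,\ell')\in\mathcal{E}\times\mathcal{E}\mid\hat\rho(\ell,\ell')=a\}$. Let $k\in\{1,2,\ldots,m-1\}$ with $\gcd(k,m)=1$, and write $\sigma=2^k$. Then the orbitals on $\mathcal{E}$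 (the orbits on $\mathcal{E}\times\mathcal{E}$) of the subgroup of $\mathrm{PGL}(3,q)$ fixing $\mathcal{O}$ setwise (a group isomorphic to $\mathrm{PGL}(2,q)$) are exactly $\Gamma_0$ and the $\Gamma_a$, $a\in\mathbf{T}_0^*$; for all $a,b,c\in\mathbf{T}_0^*$ the set $\Gamma_c$ is nonempty and the intersection number $$p^c_{a,b}=|\{n\in\mathcal{E}\mid(\ell,n)\in\Gamma_a\text{ and }(n,\ell')\in\Gamma_b\}|$$ is the same for all $(\ell,\ell')\in\Gamma_c$; and $$\sum_{c\in\mathbf{T}_0^*}p^b_{c,c^\sigma}=q+1\qquad\text{for all } b\in\mathbf{T}_0^*.$$ -/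

import Mathlib

open scoped LinearAlgebra.Projectivization MatrixGroups Pointwise

namespace EllipticScheme

/-- The points of the projective plane `PG(2, F)`. -/
abbrev Plane (F : Type*) [Field F] : Type _ := ℙ F (Fin 3 → F)

/-- The line `v^⊥` of the plane, as a set of points; every line is of this form. -/
def line {F : Type*} [Field F] (v : Plane F) : Set (Plane F) :=
  {P | Projectivization.orthogonal P v}

theorem affine_ne_zero {F : Type*} [Field F] (x : F) : ![x, x ^ 2, 1] ≠ 0 :=
  fun h => one_ne_zero (congrFun h 2)

theorem infinity_ne_zero {F : Type*} [Field F] : ![(0 : F), 1, 0] ≠ 0 :=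
  fun h => one_ne_zero (congrFun h 1)

theorem one_cons_ne_zero {F : Type*} [Field F] (x y : F) : ![1, x, y] ≠ 0 :=
  fun h => one_ne_zero (congrFun h 0)

/-- The nonsingular conic `{(ξ, ξ², 1)} ∪ {(0, 1, 0)}`. -/
def conic (F : Type*) [Field F] : Set (Plane F) :=
  {P | ∃ x : F, P = Projectivization.mk F ![x, x ^ 2, 1] (affine_ne_zero x)} ∪
    {Projectivization.mk F ![0, 1, 0] infinity_ne_zero}

/-- The exterior lines: the lines that contain no point of the conic. -/
def exteriorLines (F : Type*) [Field F] : Set (Set (Plane F)) :=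
  {l | (∃ v : Plane F, l = line v) ∧ l ∩ conic F = ∅}

/-- The subgroup of `PGL(3, F)` fixing the conic setwise (isomorphic to `PGL(2, F)`). -/
def conicGroup (F : Type*) [Field F] : Subgroup PGL(3, F) :=
  MulAction.stabilizer PGL(3, F) (conic F)

/-- The orbitals of the group of the conic on the set of exterior lines: its orbits on ordered
pairs of exterior lines. -/
def orbitals (F : Type*) [Field F] : Set (Set (Set (Plane F) × Set (Plane F))) :=
  {R | ∃ l ∈ exteriorLines F, ∃ l' ∈ exteriorLines F, R = MulAction.orbit (conicGroup F) (l, l')}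

/-- The line `(1, x, y)^⊥`. -/
def affineLine {F : Type*} [Field F] (x y : F) : Set (Plane F) :=
  line (Projectivization.mk F ![1, x, y] (one_cons_ne_zero x y))

/-- `ρ̂` of the two lines `(1, x, y)^⊥` and `(1, z, u)^⊥`. -/
def rho {F : Type*} [Field F] (x y z u : F) : F :=
  x ^ 2 * u ^ 2 + y ^ 2 * z ^ 2 + (x + z) * (y + u)

/-- The class `Γ_a`, for nonzero `a`: the pairs of exterior lines at which `ρ̂` takes the
value `a`. -/
def cls {F : Type*} [Field F] (a : F) : Set (Set (Plane F) × Set (Plane F)) :=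
  {p | p.1 ∈ exteriorLines F ∧ p.2 ∈ exteriorLines F ∧
    ∃ x y z u : F, p.1 = affineLine x y ∧ p.2 = affineLine z u ∧ rho x y z u = a}

/-- The diagonal class `Γ_0`. -/
def diagCls (F : Type*) [Field F] : Set (Set (Plane F) × Set (Plane F)) :=
  {p | p.1 ∈ exteriorLines F ∧ p.2 = p.1}

open Classical in
/-- The nonzero elements of absolute trace `0`. -/
noncomputable def T0star (F : Type*) [Field F] [Fintype F] [Algebra (ZMod 2) F] : Finset F :=
  {x : F | Algebra.trace (ZMod 2) F x = 0 ∧ x ≠ 0}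

/-- `n` is the intersection number `p^c_{a,b}`: the class `Γ_c` is nonempty and, for every pair
`(l, l')` in it, exactly `n` exterior lines `k` satisfy `(l, k) ∈ Γ_a` and `(k, l') ∈ Γ_b`. -/
def IsIntersectionNumber {F : Type*} [Field F] (a b c : F) (n : ℕ) : Prop :=
  (cls c).Nonempty ∧ ∀ p ∈ cls c,
    {k | k ∈ exteriorLines F ∧ (p.1, k) ∈ cls a ∧ (k, p.2) ∈ cls b}.ncard = n

end EllipticScheme

/-!
An exterior line is `(1, x, y)^⊥` with `Tr (x y) = 1`, by the solvability criterion for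
Artin–Schreier equations (`affineLine_mem_exteriorLines`). An element of the group of the conic
preserves the quadratic form `a₀² + a₁ a₂` up to a scalar, hence fixes the nucleus `(1, 0, 0)` and
acts on the pairs `(x, y)` by affine maps, which preserve `ρ̂` (`exists_isIsometryParam`,
`IsIsometryParam.rho_eq`). It is transitive on the exterior lines, and the stabilizer of
`(1, 1, 1)^⊥` acts on differences of coordinates by multiplications of norm `1`, so it is transitive
on the lines at given `ρ̂` from `(1, 1, 1)^⊥`. This gives the orbitals, and with them the
intersection numbers (`orbitals_eq`, `isIntersectionNumber_interNum`).

For the sum formula, sort the lines `(1, x, y)^⊥` by their coordinate `x`. The number of lines with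
first coordinate `t` that are in relation `d` to a given exterior line `(1, s, v)^⊥` is
`1 - χ (s √d / (s + t))` with `χ = (-1) ^ Tr` if `s ≠ t`, and `1` if `s = t` (`fibreCount`,
`card_rho_eq`); it does not depend on `v`. So counting the paths from `(1, 1, 1)^⊥` through a
line `(1, s, ·)^⊥` to the lines `(1, t, ·)^⊥` turns products of classes into sums over `s` alone
(`sum_interNum_mul_fibreCount`). In the resulting sum of
`fibreCount c 1 s * fibreCount (c ^ σ) s t` over `c` and `s`, orthogonality of characters leaves
the number of `s ∉ {0, 1, t}` with `(1 + s) ^ (-σ) + s / (s + t) ∈ {0, 1}`, that is, with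
`s ^ (σ + 1) = t` or `s ^ (σ - 1) = t⁻¹`. As `2 ^ m - 1` is coprime to `σ + 1` and to `σ - 1`, there
are exactly two such `s` if `t ≠ 1` and none if `t = 1` (`card_exceptional`). Consequently the
numbers `∑ c, p^b_{c, c^σ}` satisfy the same linear equations, one for each `t`, as the constant
`q + 1` (`sum_fibreCount_mul`), and these equations have only one solution, by Fourier inversion
(`eq_zero_of_sum_mul_fibreCount`).
-/

namespace EllipticScheme

/-! ### Characters of a finite field of characteristic 2, and the form `ρ̂` -/

section FiniteField

open scoped Classical

variable {F : Type*} [Field F] [Algebra (ZMod 2) F]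

theorem charP_two (F : Type*) [Field F] [Algebra (ZMod 2) F] : CharP F 2 :=
  charP_of_injective_algebraMap (algebraMap (ZMod 2) F).injective 2

theorem two_eq_zero (F : Type*) [Field F] [Algebra (ZMod 2) F] : (2 : F) = 0 := by
  have := charP_two F
  exact CharTwo.two_eq_zero

theorem add_eq_zero_iff_eq_of_char_two {a b : F} : a + b = 0 ↔ a = b := by
  have h2 := two_eq_zero F
  constructor
  · intro h; linear_combination h - b * h2
  · intro h; linear_combination h + b * h2

/-- The canonical additive character `x ↦ (-1) ^ Tr x` of a finite field of characteristic `2`. -/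
noncomputable def chi (x : F) : ℤ := if Algebra.trace (ZMod 2) F x = 0 then 1 else -1

theorem chi_zero : chi (0 : F) = 1 := by simp [chi]

theorem chi_of_trace_eq_zero {x : F} (h : Algebra.trace (ZMod 2) F x = 0) : chi x = 1 := by
  simp [chi, h]

theorem chi_of_trace_eq_one {x : F} (h : Algebra.trace (ZMod 2) F x = 1) : chi x = -1 := by
  simp [chi, h]

theorem chi_add (x y : F) : chi (x + y) = chi x * chi y := by
  have key : ∀ a b : ZMod 2, (if a + b = 0 then (1 : ℤ) else -1) =
      (if a = 0 then 1 else -1) * (if b = 0 then 1 else -1) := by decide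
  simp only [chi, map_add]
  convert key _ _

theorem add_pow_two_pow (x y : F) (k : ℕ) : (x + y) ^ 2 ^ k = x ^ 2 ^ k + y ^ 2 ^ k := by
  have := charP_two F
  have : ExpChar F 2 := ExpChar.prime Nat.prime_two
  exact add_pow_expChar_pow x y 2 k

/-- In terms of the difference `(s, t)` of the coordinates, `ρ̂` is the square of the value of the
quadratic form `x X² + X Z + y Z²` at `(√t, √s)`. -/
theorem rho_add (x y s t : F) :
    rho x y (x + s) (y + t) = x ^ 2 * t ^ 2 + y ^ 2 * s ^ 2 + s * t := by
  have := charP_two F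
  unfold rho
  grind

variable [Fintype F]

theorem trace_sq (x : F) : Algebra.trace (ZMod 2) F (x ^ 2) = Algebra.trace (ZMod 2) F x := by
  have := Algebra.trace_eq_of_algEquiv (FiniteField.frobeniusAlgEquivOfAlgebraic (ZMod 2) F) x
  simpa using this

theorem trace_pow_two_pow (x : F) (k : ℕ) :
    Algebra.trace (ZMod 2) F (x ^ 2 ^ k) = Algebra.trace (ZMod 2) F x := by
  induction k with
  | zero => simp
  | succ k ih => rw [pow_succ, pow_mul, trace_sq, ih]

theorem chi_pow_two_pow (x : F) (k : ℕ) : chi (x ^ 2 ^ k) = chi x := by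
  simp [chi, trace_pow_two_pow]

theorem chi_sq (x : F) : chi (x ^ 2) = chi x := by
  simp [chi, trace_sq]

theorem sum_chi_mul (a : F) :
    ∑ x : F, chi (a * x) = if a = 0 then (Fintype.card F : ℤ) else 0 := by
  split_ifs with ha
  · simp [ha, chi_zero]
  · obtain ⟨b, hb⟩ : ∃ b : F, Algebra.trace (ZMod 2) F (a * b) ≠ 0 := by
      by_contra! hf
      exact ha ((traceForm_nondegenerate (ZMod 2) F).1 a hf)
    have h1 : chi (a * b) = -1 := by simp only [chi]; rw [if_neg hb]
    have h2 : ∑ x : F, chi (a * x) = ∑ x : F, chi (a * (x + b)) :=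
      (Equiv.sum_comp (Equiv.addRight b) fun x => chi (a * x)).symm
    simp only [mul_add, chi_add, h1, ← Finset.sum_mul] at h2
    linarith

theorem bijective_pow_two_pow (k : ℕ) : Function.Bijective fun x : F => x ^ 2 ^ k := by
  have := charP_two F
  have : ExpChar F 2 := ExpChar.prime Nat.prime_two
  exact Finite.injective_iff_bijective.1 (iterateFrobenius F 2 k).injective

/-- Each fibre of the Artin–Schreier map `y ↦ y² + y` has `1 + (-1) ^ Tr a` elements. The
fibre is counted by orthogonality of characters. -/
theorem card_artinSchreier (a : F) :
    ((Finset.univ.filter fun y : F => y ^ 2 + y = a).card : ℤ) = 1 + chi a := by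
  have hq : (Fintype.card F : ℤ) ≠ 0 := by exact_mod_cast Fintype.card_ne_zero
  have e1 : ∑ y : F, ∑ w : F, chi ((y ^ 2 + y + a) * w) =
      (Fintype.card F : ℤ) * (Finset.univ.filter fun y : F => y ^ 2 + y = a).card := by
    simp only [sum_chi_mul, add_eq_zero_iff_eq_of_char_two]
    rw [Finset.sum_ite, Finset.sum_const_zero, add_zero, Finset.sum_const, nsmul_eq_mul, mul_comm]
  have e2 : ∑ y : F, ∑ w : F, chi ((y ^ 2 + y + a) * w) = Fintype.card F * (1 + chi a) := by
    rw [Finset.sum_comm]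
    -- After `w = v²`, the trace of `y² v² + y v²` is that of `y (v + v²)`.
    have hsub : ∀ w : F, ∑ y : F, chi ((y ^ 2 + y + a) * w ^ 2) =
        if w = 0 ∨ w = 1 then Fintype.card F * chi (a * w) else 0 := by
      intro w
      have : ∀ y : F, chi ((y ^ 2 + y + a) * w ^ 2) = chi (a * w ^ 2) * chi ((w + w ^ 2) * y) := by
        intro y
        rw [show (y ^ 2 + y + a) * w ^ 2 = a * w ^ 2 + ((y * w) ^ 2 + w ^ 2 * y) by ring,
          chi_add, chi_add, chi_sq, ← chi_add, add_mul, mul_comm y w]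
      simp only [this, ← Finset.mul_sum, sum_chi_mul]
      have hw : w + w ^ 2 = 0 ↔ w = 0 ∨ w = 1 := by
        rw [show w + w ^ 2 = w * (w + 1) by ring, mul_eq_zero, add_eq_zero_iff_eq_of_char_two]
      simp only [hw]
      split_ifs with h
      · rcases h with rfl | rfl <;> simp [mul_comm]
      · simp
    rw [← (bijective_pow_two_pow (F := F) 1).sum_comp]
    simp only [pow_one, hsub]
    rw [← Finset.sum_filter, show (Finset.univ.filter fun w : F => w = 0 ∨ w = 1) = {0, 1} by
      ext; simp, Finset.sum_pair zero_ne_one]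
    simp [chi_zero]; ring
  exact mul_left_cancel₀ hq (e1.symm.trans e2)

/-- The elements of absolute trace `0`. -/
noncomputable def T0 (F : Type*) [Field F] [Fintype F] [Algebra (ZMod 2) F] : Finset F :=
  {x : F | Algebra.trace (ZMod 2) F x = 0}

theorem mem_T0 {x : F} : x ∈ T0 F ↔ Algebra.trace (ZMod 2) F x = 0 := by simp [T0]

theorem mem_T0star {x : F} : x ∈ T0star F ↔ Algebra.trace (ZMod 2) F x = 0 ∧ x ≠ 0 := by
  simp [T0star]

theorem sum_T0 (f : F → ℤ) : ∑ c ∈ T0 F, f c = f 0 + ∑ c ∈ T0star F, f c := by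
  have : T0 F = insert 0 (T0star F) := by
    ext x
    by_cases hx : x = 0 <;> simp [mem_T0, mem_T0star, hx]
  rw [this, Finset.sum_insert (by simp [mem_T0star])]

/-- Orthogonality on the hyperplane of trace `0`, whose annihilator is `{0, 1}`. -/
theorem two_mul_sum_T0_chi (a : F) :
    2 * ∑ c ∈ T0 F, chi (c * a) = if a = 0 ∨ a = 1 then (Fintype.card F : ℤ) else 0 := by
  have h : 2 * ∑ c ∈ T0 F, chi (c * a) = ∑ c : F, chi (a * c) + ∑ c : F, chi ((a + 1) * c) := by
    rw [← Finset.sum_add_distrib, T0, Finset.sum_filter, Finset.mul_sum]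
    refine Finset.sum_congr rfl fun c _ => ?_
    rw [add_mul, one_mul, chi_add, mul_comm c a]
    by_cases hc : Algebra.trace (ZMod 2) F c = 0
    · rw [if_pos hc, chi_of_trace_eq_zero hc]; ring
    · rw [if_neg hc, show chi c = -1 by simp [chi, hc]]; ring
  rw [h, sum_chi_mul, sum_chi_mul, add_eq_zero_iff_eq_of_char_two]
  by_cases h0 : a = 0
  · simp [h0]
  · simp [h0]

theorem two_mul_card_T0 : 2 * ((T0 F).card : ℤ) = Fintype.card F := by
  simpa [chi_zero] using two_mul_sum_T0_chi (0 : F)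

/-- In particular, `ρ̂` has trace `0` at pairs of exterior lines. -/
theorem trace_rho (x y z u : F) : Algebra.trace (ZMod 2) F (rho x y z u) =
    Algebra.trace (ZMod 2) F (x * y) + Algebra.trace (ZMod 2) F (z * u) := by
  have : rho x y z u = (x * u) ^ 2 + x * u + ((y * z) ^ 2 + y * z) + (x * y + z * u) := by
    unfold rho; ring
  have h (a : F) : Algebra.trace (ZMod 2) F (a ^ 2 + a) = 0 := by
    rw [map_add, trace_sq]; exact CharTwo.add_self_eq_zero _
  rw [this, map_add, map_add, h, h, map_add]; ring

/-- The number of lines `(1, t, u)^⊥` with given `t` in the relation `ρ̂ = d` to a fixed exterior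
line `(1, s, v)^⊥`, where `Tr d = 0`. It does not depend on `v`, see `card_rho_eq`. -/
noncomputable def fibreCount (d s t : F) : ℤ :=
  if s = t then 1 else 1 - chi (s ^ 2 * d / (s + t) ^ 2)

theorem card_rho_eq {s v : F} (hsv : Algebra.trace (ZMod 2) F (s * v) = 1) (t d : F) :
    ((Finset.univ.filter fun u : F => rho s v t u = d).card : ℤ) = fibreCount d s t := by
  have := charP_two F
  have hs : s ≠ 0 := by rintro rfl; simp at hsv
  unfold fibreCount
  split_ifs with hst
  · subst hst
    obtain ⟨e, rfl⟩ := (bijective_pow_two_pow (F := F) 1).2 d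
    norm_cast
    rw [Finset.card_eq_one]
    refine ⟨v + e / s, ?_⟩
    ext u
    simp only [Finset.mem_filter, Finset.mem_univ, true_and, Finset.mem_singleton, pow_one]
    -- For `s = t` the equation is purely inseparable, with the single solution `v + e / s`.
    have h1 : rho s v s u = (s * (u + v)) ^ 2 := by unfold rho; grind
    have h2 := (bijective_pow_two_pow (F := F) 1).1.eq_iff (a := s * (u + v)) (b := e)
    simp only [pow_one] at h2
    rw [h1, h2]
    grind
  · obtain ⟨e, rfl⟩ : ∃ e, t = s + e := ⟨t - s, by ring⟩
    have he : e ≠ 0 := by rintro rfl; simp at hst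
    have hse : s + (s + e) = e := by grind
    have h1 : chi (s ^ 2 * d / e ^ 2 + (s * v) ^ 2) = -chi (s ^ 2 * d / e ^ 2) := by
      rw [chi_add, chi_sq, chi_of_trace_eq_one hsv]; ring
    rw [hse, sub_eq_add_neg, ← h1, ← card_artinSchreier]
    norm_cast
    have key (y : F) : rho s v (s + e) (v + e * y / s ^ 2) = d ↔
        y ^ 2 + y = s ^ 2 * d / e ^ 2 + (s * v) ^ 2 := by
      rw [rho_add]
      have : s ^ 2 * d / e ^ 2 + (s * v) ^ 2 - (y ^ 2 + y) = s ^ 2 / e ^ 2 *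
          (d - (s ^ 2 * (e * y / s ^ 2) ^ 2 + v ^ 2 * e ^ 2 + e * (e * y / s ^ 2))) := by
        field_simp
        grind
      have hne : s ^ 2 / e ^ 2 ≠ 0 := by positivity
      rw [eq_comm, ← sub_eq_zero, eq_comm (a := y ^ 2 + y), ← sub_eq_zero (b := y ^ 2 + y), this,
        mul_eq_zero, or_iff_right hne]
    -- The substitution `u = v + e y / s²` turns the equation into an Artin–Schreier equation.
    symm
    refine Finset.card_bij (fun y _ => v + e * y / s ^ 2) ?_ ?_ ?_
    · intro y hy
      simpa [key] using hy
    · intro y _ y' _ h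
      field_simp at h
      grind
    · intro u hu
      have hu' : v + e * (s ^ 2 * (u - v) / e) / s ^ 2 = u := by field_simp; ring
      refine ⟨s ^ 2 * (u - v) / e, ?_, hu'⟩
      have := key (s ^ 2 * (u - v) / e)
      rw [hu'] at this
      simpa [this] using hu

/-- Exterior lines are at `ρ̂ = 0` only from themselves: the equation `ρ̂ = 0` has
`1 - χ 0 = 0` solutions with a different first coordinate. -/
theorem rho_eq_zero_iff {x y z u : F} (h : Algebra.trace (ZMod 2) F (x * y) = 1) :
    rho x y z u = 0 ↔ z = x ∧ u = y := by
  have := charP_two F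
  have hself : rho x y x y = 0 := by unfold rho; grind
  constructor
  · intro h0
    have hu : u ∈ Finset.univ.filter fun w : F => rho x y z w = 0 := by simp [h0]
    have hpos := Finset.card_pos.2 ⟨u, hu⟩
    have hc := card_rho_eq h z 0
    unfold fibreCount at hc
    split_ifs at hc with hxz
    · subst hxz
      refine ⟨rfl, Finset.card_le_one.1 (by exact_mod_cast hc.le) u hu y (by simp [hself])⟩
    · rw [mul_zero, zero_div, chi_zero, sub_self] at hc
      exact absurd hpos (by exact_mod_cast hc.not_gt)
  · rintro ⟨rfl, rfl⟩
    exact hself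

end FiniteField

/-! ### The conic, its exterior lines and its group -/

section Geometry

open scoped Classical

variable {F : Type*} [Field F]

theorem mk_mem_affineLine {a : Fin 3 → F} (ha : a ≠ 0) (x y : F) :
    Projectivization.mk F a ha ∈ affineLine x y ↔ a 0 + a 1 * x + a 2 * y = 0 := by
  simp [affineLine, line, Projectivization.orthogonal_mk, dotProduct, Fin.sum_univ_three]

/-- The conic is the zero locus of the quadratic form `a₀² - a₁ a₂`. -/
theorem mk_mem_conic {a : Fin 3 → F} (ha : a ≠ 0) :
    Projectivization.mk F a ha ∈ conic F ↔ a 0 ^ 2 = a 1 * a 2 := by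
  simp only [conic, Set.mem_union, Set.mem_ofPred_eq, Set.mem_singleton_iff,
    Projectivization.mk_eq_mk_iff']
  constructor
  · rintro (⟨x, c, rfl⟩ | ⟨c, rfl⟩)
    · simp; ring
    · simp
  · intro h
    by_cases h2 : a 2 = 0
    · right
      refine ⟨a 1, ?_⟩
      have h0 : a 0 = 0 := by simpa [h2] using h
      ext i
      fin_cases i <;> simp [h0, h2]
    · left
      refine ⟨a 0 / a 2, a 2, ?_⟩
      ext i
      fin_cases i
      · simp; field_simp
      · simp; field_simp; rw [h, mul_comm]
      · simp

theorem GL_smul_eq_mulVec (A : GL (Fin 3) F) (v : Fin 3 → F) : A • v = A.1.mulVec v := rfl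

theorem cubic_coeff_eq_zero [Fintype F] (hq : 4 ≤ Fintype.card F) {a b c d : F}
    (h : ∀ w : F, a * w ^ 3 + b * w ^ 2 + c * w + d = 0) : a = 0 ∧ b = 0 ∧ c = 0 ∧ d = 0 := by
  let f : Polynomial F := .C a * .X ^ 3 + .C b * .X ^ 2 + .C c * .X + .C d
  have hf : f = 0 := by
    have hdeg : f.natDegree ≤ 3 := Polynomial.natDegree_cubic_le
    refine Polynomial.eq_zero_of_natDegree_lt_card_of_eval_eq_zero f Function.injective_id
      (fun w => ?_) (by omega)
    simpa [f] using h w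
  have hc (n : ℕ) : f.coeff n = 0 := by rw [hf, Polynomial.coeff_zero]
  have h0 := hc 0
  have h1 := hc 1
  have h2 := hc 2
  have h3 := hc 3
  simp [f, Polynomial.coeff_X, Polynomial.coeff_C] at h0 h1 h2 h3
  exact ⟨h3, h2, h1, h0⟩

/-- The image of the line `(1, x, y)^⊥` under a matrix `A` is read off from the row vector
`(1, x, y) A⁻¹`. -/
theorem smul_affineLine (A : GL (Fin 3) F) {x y z u e : F} (he : e ≠ 0)
    (h : Matrix.vecMul ![1, x, y] (A⁻¹ : GL (Fin 3) F).1 = e • ![1, z, u]) :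
    (Matrix.ProjGenLinGroup.mk A : PGL(3, F)) • affineLine x y = affineLine z u := by
  ext P
  rw [Set.mem_smul_set_iff_inv_smul_mem, ← map_inv]
  induction P using Projectivization.ind with
  | h v hv =>
    rw [Projectivization.PGL.mk_smul_mk, affineLine, affineLine, line, line, Set.mem_ofPred_eq,
      Set.mem_ofPred_eq, Projectivization.orthogonal_mk, Projectivization.orthogonal_mk,
      GL_smul_eq_mulVec, dotProduct_comm, Matrix.dotProduct_mulVec, h, smul_dotProduct, smul_eq_mul,
      mul_eq_zero, or_iff_right he, dotProduct_comm]

theorem smul_mem_exteriorLines {g : PGL(3, F)} (hg : g ∈ conicGroup F) {x y z u : F}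
    (h : g • affineLine x y = affineLine z u) (hl : affineLine x y ∈ exteriorLines F) :
    affineLine z u ∈ exteriorLines F := by
  refine ⟨⟨_, rfl⟩, ?_⟩
  rw [← h, ← (MulAction.mem_stabilizer_iff.1 hg : g • conic F = conic F), ← Set.smul_set_inter,
    hl.2, Set.smul_set_empty]

variable [Algebra (ZMod 2) F]

theorem affineLine_inj {x y z u : F} : affineLine x y = affineLine z u ↔ x = z ∧ y = u := by
  have := charP_two F
  constructor
  · intro h
    have h1 : ![x, 1, 0] ≠ 0 := fun h => one_ne_zero (congrFun h 1)
    have h2 : ![y, 0, 1] ≠ 0 := fun h => one_ne_zero (congrFun h 2)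
    have e1 : Projectivization.mk F _ h1 ∈ affineLine z u := by
      rw [← h, mk_mem_affineLine]; simp [CharTwo.add_self_eq_zero]
    have e2 : Projectivization.mk F _ h2 ∈ affineLine z u := by
      rw [← h, mk_mem_affineLine]; simp [CharTwo.add_self_eq_zero]
    rw [mk_mem_affineLine] at e1 e2
    simp [add_eq_zero_iff_eq_of_char_two] at e1 e2
    exact ⟨e1, e2⟩
  · rintro ⟨rfl, rfl⟩; rfl

theorem mem_cls_iff {a x y z u : F} : (affineLine x y, affineLine z u) ∈ cls a ↔
    affineLine x y ∈ exteriorLines F ∧ affineLine z u ∈ exteriorLines F ∧ rho x y z u = a := by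
  simp only [cls, Set.mem_ofPred_eq, affineLine_inj]
  constructor
  · rintro ⟨h1, h2, _, _, _, _, ⟨rfl, rfl⟩, ⟨rfl, rfl⟩, h⟩; exact ⟨h1, h2, h⟩
  · rintro ⟨h1, h2, h⟩; exact ⟨h1, h2, x, y, z, u, ⟨rfl, rfl⟩, ⟨rfl, rfl⟩, h⟩

/-- The parameters of a matrix `[[1, p, r], [0, a, b], [0, c, d]]` that preserves the quadratic
form `a₀² + a₁ a₂` in characteristic `2`. -/
structure IsIsometryParam (a b c d p r : F) : Prop where
  sq_p : p ^ 2 = a * c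
  sq_r : r ^ 2 = b * d
  det : a * d + b * c = 1

theorem IsIsometryParam.rho_eq {a b c d p r : F} (h : IsIsometryParam a b c d p r) (x y z u : F) :
    rho (p + x * a + y * c) (r + x * b + y * d) (p + z * a + u * c) (r + z * b + u * d) =
      rho x y z u := by
  have := charP_two F
  obtain ⟨hp, hr, hd⟩ := h
  obtain ⟨s, rfl⟩ : ∃ s, z = x + s := ⟨z - x, by ring⟩
  obtain ⟨t, rfl⟩ : ∃ t, u = y + t := ⟨u - y, by ring⟩
  rw [show p + (x + s) * a + (y + t) * c = p + x * a + y * c + (s * a + t * c) by ring,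
    show r + (x + s) * b + (y + t) * d = r + x * b + y * d + (s * b + t * d) by ring,
    rho_add, rho_add]
  have h2 := two_eq_zero F
  have e1 : (p + x * a + y * c) * (s * b + t * d) + (r + x * b + y * d) * (s * a + t * c) =
      x * t + y * s + (p * (s * b + t * d) + r * (s * a + t * c)) := by
    linear_combination (x * t + y * s) * hd + (x * s * a * b + y * t * c * d) * h2
  have e2 : (p + x * a + y * c) ^ 2 * (s * b + t * d) ^ 2 +
      (r + x * b + y * d) ^ 2 * (s * a + t * c) ^ 2 =
      x ^ 2 * t ^ 2 + y ^ 2 * s ^ 2 +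
        (p ^ 2 * (s * b + t * d) ^ 2 + r ^ 2 * (s * a + t * c) ^ 2) := by
    have := congrArg (· ^ 2) e1
    simp only [CharTwo.add_sq, mul_pow] at this ⊢
    linear_combination this
  rw [e2, hp, hr]
  linear_combination (s ^ 2 * a * b + t ^ 2 * c * d + s * t) * hd +
    (s ^ 2 * a * b + t ^ 2 * c * d + 2 * a * b * c * d * s * t) * h2

/-- The stabilizer of `(1, 1, 1)^⊥` acts on differences of coordinates by the multiplications of
norm `1` for the norm form `s² + s t + t²`, hence transitively on the vectors of given norm. -/
theorem exists_isIsometryParam_fix_one {s t s' t' : F} (h0 : s ^ 2 + s * t + t ^ 2 ≠ 0)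
    (h : s ^ 2 + s * t + t ^ 2 = s' ^ 2 + s' * t' + t' ^ 2) :
    ∃ a b c d p r : F, IsIsometryParam a b c d p r ∧ p + a + c = 1 ∧ r + b + d = 1 ∧
      s * a + t * c = s' ∧ s * b + t * d = t' := by
  have := charP_two F
  obtain ⟨n, hn⟩ : ∃ n, n = s ^ 2 + s * t + t ^ 2 := ⟨_, rfl⟩
  rw [← hn] at h0 h
  -- `g` and `k` are the coordinates of the quotient of `(s', t')` by `(s, t)` in the quadratic
  -- algebra with norm form `s² + s t + t²`.
  obtain ⟨g, hg⟩ : ∃ g, g = (s' * (s + t) + t' * t) / n := ⟨_, rfl⟩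
  obtain ⟨k, hk⟩ : ∃ k, k = (s * t' + t * s') / n := ⟨_, rfl⟩
  have hg' : g * n = s' * (s + t) + t' * t := by rw [hg]; field_simp
  have hk' : k * n = s * t' + t * s' := by rw [hk]; field_simp
  have hnorm : g ^ 2 + g * k + k ^ 2 = 1 := by
    have : (g ^ 2 + g * k + k ^ 2) * n ^ 2 = 1 * n ^ 2 := by
      have : (g ^ 2 + g * k + k ^ 2) * n ^ 2 =
        (s ^ 2 + s * t + t ^ 2) * (s' ^ 2 + s' * t' + t' ^ 2) := by grind
      rw [this, ← hn, ← h]; ring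
    exact mul_right_cancel₀ (pow_ne_zero 2 h0) this
  refine ⟨g, k, k, g + k, 1 + g + k, 1 + g, ⟨?_, ?_, ?_⟩, ?_, ?_, ?_, ?_⟩
  · grind
  · grind
  · grind
  · grind
  · grind
  · refine mul_right_cancel₀ h0 ?_
    grind
  · refine mul_right_cancel₀ h0 ?_
    grind

variable [Fintype F]

/-- The line `(1, x, y)^⊥` meets the conic in `(0, 1, 0)` if `x = 0`, and in the points
`(w, w², 1)` with `(x w)² + x w = x y`. -/
theorem affineLine_mem_exteriorLines {x y : F} :
    affineLine x y ∈ exteriorLines F ↔ Algebra.trace (ZMod 2) F (x * y) = 1 := by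
  have := charP_two F
  have h1 : affineLine x y ∈ exteriorLines F ↔ x ≠ 0 ∧ ∀ w : F, w + w ^ 2 * x + y ≠ 0 := by
    have : affineLine x y ∈ exteriorLines F ↔ affineLine x y ∩ conic F = ∅ :=
      ⟨fun h => h.2, fun h => ⟨⟨_, rfl⟩, h⟩⟩
    rw [this, Set.eq_empty_iff_forall_notMem]
    constructor
    · intro h
      refine ⟨fun hx => h (Projectivization.mk F ![0, 1, 0] infinity_ne_zero) ⟨?_, Or.inr rfl⟩,
        fun w hw => h (Projectivization.mk F ![w, w ^ 2, 1] (affine_ne_zero w))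
          ⟨?_, Or.inl ⟨w, rfl⟩⟩⟩
      · rw [mk_mem_affineLine]; simp [hx]
      · rw [mk_mem_affineLine]; simpa using hw
    · rintro ⟨hx, hw⟩ P ⟨hP, ⟨w, rfl⟩ | hP'⟩
      · rw [mk_mem_affineLine] at hP
        exact hw w (by simpa using hP)
      · rw [Set.mem_singleton_iff] at hP'
        rw [hP', mk_mem_affineLine] at hP
        simp at hP
        exact hx hP
  have hc := card_artinSchreier (x * y)
  rw [h1]
  constructor
  · rintro ⟨hx, hw⟩
    rw [Finset.card_eq_zero.2] at hc
    · by_contra hne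
      have h0 : Algebra.trace (ZMod 2) F (x * y) = 0 := by
        revert hne; generalize Algebra.trace (ZMod 2) F (x * y) = a; revert a; decide
      simp [chi_of_trace_eq_zero h0] at hc
    · rw [Finset.filter_eq_empty_iff]
      intro v _ hv
      apply hw (v / x)
      field_simp
      grind
  · intro h
    have hx : x ≠ 0 := by rintro rfl; simp at h
    refine ⟨hx, fun w hw => ?_⟩
    rw [chi_of_trace_eq_one h, add_neg_cancel, Nat.cast_eq_zero, Finset.card_eq_zero,
      Finset.filter_eq_empty_iff] at hc
    exact hc (Finset.mem_univ (x * w)) (by grind)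

theorem exists_affineLine_of_mem_exteriorLines {l : Set (Plane F)} (hl : l ∈ exteriorLines F) :
    ∃ x y : F, Algebra.trace (ZMod 2) F (x * y) = 1 ∧ l = affineLine x y := by
  have := charP_two F
  obtain ⟨⟨v, rfl⟩, hv⟩ := id hl
  induction v using Projectivization.ind with
  | h w hw =>
    have hmem {a : Fin 3 → F} (ha : a ≠ 0) : Projectivization.mk F a ha ∈
        line (Projectivization.mk F w hw) ↔ a 0 * w 0 + a 1 * w 1 + a 2 * w 2 = 0 := by
      simp [line, Projectivization.orthogonal_mk, dotProduct, Fin.sum_univ_three]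
    rw [Set.eq_empty_iff_forall_notMem] at hv
    -- A line through the nucleus `(1, 0, 0)` is tangent to the conic.
    have h0 : w 0 ≠ 0 := by
      intro h0
      by_cases h1 : w 1 = 0
      · refine hv (Projectivization.mk F ![0, 1, 0] infinity_ne_zero) ⟨?_, Or.inr rfl⟩
        rw [hmem]; simp [h1]
      · obtain ⟨s, hs⟩ := (bijective_pow_two_pow (F := F) 1).2 (w 2 / w 1)
        refine hv (Projectivization.mk F ![s, s ^ 2, 1] (affine_ne_zero s)) ⟨?_, Or.inl ⟨s, rfl⟩⟩
        rw [hmem]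
        simp only [pow_one] at hs
        simp [h0, hs, h1, CharTwo.add_self_eq_zero]
    have e : line (Projectivization.mk F w hw) = affineLine (w 1 / w 0) (w 2 / w 0) := by
      unfold affineLine
      congr 1
      rw [Projectivization.mk_eq_mk_iff']
      refine ⟨w 0, ?_⟩
      ext i
      fin_cases i <;> simp <;> field_simp
    rw [e] at hl ⊢
    exact ⟨_, _, affineLine_mem_exteriorLines.1 hl, rfl⟩

/-- Every isometry of `a₀² + a₁ a₂` fixing `(1, 0, 0)` induces an element of the group of the
conic. -/
theorem IsIsometryParam.exists_smul_eq {a b c d p r : F} (h : IsIsometryParam a b c d p r) :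
    ∃ g ∈ conicGroup F, ∀ x y : F,
      g • affineLine x y = affineLine (p + x * a + y * c) (r + x * b + y * d) := by
  have := charP_two F
  obtain ⟨hp, hr, hd⟩ := h
  let B : Matrix (Fin 3) (Fin 3) F := !![1, p, r; 0, a, b; 0, c, d]
  have hB : B.det = 1 := by
    simp [B, Matrix.det_fin_three]
    grind
  let A : GL (Fin 3) F := Matrix.GeneralLinearGroup.mkOfDetNeZero B (by simp [hB])
  have hA : A.1 = B := rfl
  have hmem : (Matrix.ProjGenLinGroup.mk A : PGL(3, F)) ∈ conicGroup F := by
    have : Finite (Plane F) := Quotient.finite _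
    refine (MulAction.mem_stabilizer_set_iff_smul_set_subset (Set.toFinite _)).2 ?_
    rintro _ ⟨P, hP, rfl⟩
    induction P using Projectivization.ind with
    | h v hv =>
      rw [mk_mem_conic] at hP
      simp only
      rw [Projectivization.PGL.mk_smul_mk, mk_mem_conic]
      simp [GL_smul_eq_mulVec, hA, B, Matrix.mulVec, dotProduct, Fin.sum_univ_three]
      grind
  refine ⟨_, inv_mem hmem, fun x y => ?_⟩
  rw [← map_inv]
  refine smul_affineLine _ one_ne_zero ?_
  rw [inv_inv, hA]
  ext i
  fin_cases i <;> simp [B, Matrix.vecMul, dotProduct, Fin.sum_univ_three]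

/-- Every element of the group of the conic comes from an isometry of `a₀² + a₁ a₂` fixing
`(1, 0, 0)`: it preserves the form up to a scalar, because a quadratic form that vanishes on the
conic restricts to a polynomial of degree at most `3` on its affine part. -/
theorem exists_isIsometryParam (hq : 4 ≤ Fintype.card F) {g : PGL(3, F)} (hg : g ∈ conicGroup F) :
    ∃ a b c d p r : F, IsIsometryParam a b c d p r ∧ ∀ x y : F,
      g • affineLine x y = affineLine (p + x * a + y * c) (r + x * b + y * d) := by
  have := charP_two F
  have h2 := two_eq_zero F
  obtain ⟨A, rfl⟩ := Matrix.ProjGenLinGroup.mk_surjective g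
  obtain ⟨B, hB⟩ : ∃ B : Matrix (Fin 3) (Fin 3) F, B = (A⁻¹ : GL (Fin 3) F).1 := ⟨_, rfl⟩
  have hdet : B.det ≠ 0 := by
    rw [hB]; exact Matrix.GeneralLinearGroup.det_ne_zero _
  have hcon (v : Fin 3 → F) (hv : v ≠ 0) (h : v 0 ^ 2 = v 1 * v 2) :
      (B.mulVec v) 0 ^ 2 = (B.mulVec v) 1 * (B.mulVec v) 2 := by
    have hs : (Matrix.ProjGenLinGroup.mk A)⁻¹ • conic F = conic F :=
      MulAction.mem_stabilizer_iff.1 (inv_mem hg)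
    have hm := Set.smul_mem_smul_set (a := (Matrix.ProjGenLinGroup.mk A)⁻¹)
      ((mk_mem_conic hv).2 h)
    rw [hs, ← map_inv, Projectivization.PGL.mk_smul_mk, mk_mem_conic] at hm
    rw [hB]
    exact hm
  have hinf := hcon ![0, 1, 0] infinity_ne_zero (by simp)
  have haff (w : F) := hcon ![w, w ^ 2, 1] (affine_ne_zero w) (by simp)
  simp [Matrix.mulVec, dotProduct, Fin.sum_univ_three] at hinf haff
  -- The coefficient of `w⁴` vanishes by `hinf`, because `(0, 1, 0)` is on the conic.
  obtain ⟨c3, c2, c1, c0⟩ := cubic_coeff_eq_zero hq (a := B 1 0 * B 2 1 + B 1 1 * B 2 0)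
    (b := B 0 0 ^ 2 + (B 1 0 * B 2 0 + B 1 1 * B 2 2 + B 1 2 * B 2 1))
    (c := B 1 0 * B 2 2 + B 1 2 * B 2 0) (d := B 0 2 ^ 2 + B 1 2 * B 2 2)
    (fun w => by linear_combination haff w - w ^ 4 * hinf +
      ((B 1 0 * B 2 1 + B 1 1 * B 2 0) * w ^ 3 +
        (B 1 0 * B 2 0 + B 1 1 * B 2 2 + B 1 2 * B 2 1) * w ^ 2 +
        (B 1 0 * B 2 2 + B 1 2 * B 2 0) * w + B 1 2 * B 2 2 - B 0 0 * B 0 1 * w ^ 3 -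
        B 0 0 * B 0 2 * w - B 0 1 * B 0 2 * w ^ 2) * h2)
  clear haff hcon
  -- The nucleus `(1, 0, 0)` spans the radical of the polar form, hence is fixed.
  have hrad : ![0, B 2 0, B 1 0] = 0 := by
    refine Matrix.eq_zero_of_vecMul_eq_zero hdet ?_
    ext i
    fin_cases i <;> simp [Matrix.vecMul, dotProduct, Fin.sum_univ_three] <;> grind
  have hb2 : B 2 0 = 0 := congrFun hrad 1
  have hb1 : B 1 0 = 0 := congrFun hrad 2
  have hb0 : B 0 0 ≠ 0 := by
    intro h0
    apply hdet
    simp [Matrix.det_fin_three, h0, hb1, hb2]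
  refine ⟨B 1 1 / B 0 0, B 1 2 / B 0 0, B 2 1 / B 0 0, B 2 2 / B 0 0, B 0 1 / B 0 0, B 0 2 / B 0 0,
    ⟨?_, ?_, ?_⟩, fun x y => smul_affineLine A hb0 ?_⟩
  · field_simp; exact hinf
  · field_simp; grind
  · field_simp; grind
  · rw [← hB]
    ext i
    fin_cases i <;> simp [Matrix.vecMul, dotProduct, Fin.sum_univ_three, hb1, hb2] <;> field_simp

/-- The group of the conic is transitive on the exterior lines: each can be moved to
`(1, 1, 1)^⊥`. -/
theorem exists_isIsometryParam_to_one {x y : F} (h : Algebra.trace (ZMod 2) F (x * y) = 1)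
    (h1 : Algebra.trace (ZMod 2) F (1 : F) = 1) : ∃ a b c d p r : F, IsIsometryParam a b c d p r ∧
      p + x * a + y * c = 1 ∧ r + x * b + y * d = 1 := by
  have := charP_two F
  have hx : x ≠ 0 := by rintro rfl; simp at h
  have hc := card_artinSchreier (x * y + 1)
  have h0 : Algebra.trace (ZMod 2) F (x * y + 1) = 0 := by rw [map_add, h, h1]; rfl
  rw [chi_of_trace_eq_zero h0] at hc
  obtain ⟨r, hr⟩ : ∃ r : F, r ^ 2 + r = x * y + 1 := by
    by_contra! hne
    rw [Finset.filter_false_of_mem fun r _ => hne r] at hc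
    simp at hc
  refine ⟨1 / x, r ^ 2 / x, 0, x, 0, r, ⟨by simp, by field_simp, by field_simp; simp⟩, ?_, ?_⟩
  · field_simp; simp
  · field_simp; grind

end Geometry

/-! ### The orbitals and their intersection numbers -/

section Orbitals

variable {F : Type*} [Field F] [Algebra (ZMod 2) F] [Fintype F]

/-- The group of the conic preserves `ρ̂`. -/
theorem smul_mem_cls (hq : 4 ≤ Fintype.card F) {g : PGL(3, F)} (hg : g ∈ conicGroup F)
    {q : Set (Plane F) × Set (Plane F)} {a : F} (h : q ∈ cls a) : g • q ∈ cls a := by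
  obtain ⟨l, l'⟩ := q
  obtain ⟨h1, h2, x, y, z, u, rfl, rfl, hr⟩ := id h
  obtain ⟨_, _, _, _, _, _, hp, he⟩ := exists_isIsometryParam hq hg
  rw [Prod.smul_mk, he, he, mem_cls_iff, hp.rho_eq]
  exact ⟨smul_mem_exteriorLines hg (he x y) h1, smul_mem_exteriorLines hg (he z u) h2, hr⟩

theorem smul_mem_cls_iff (hq : 4 ≤ Fintype.card F) {g : PGL(3, F)} (hg : g ∈ conicGroup F)
    {q : Set (Plane F) × Set (Plane F)} {a : F} : g • q ∈ cls a ↔ q ∈ cls a :=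
  ⟨fun h => by simpa using smul_mem_cls hq (inv_mem hg) h, smul_mem_cls hq hg⟩

theorem exists_smul_eq_one {l : Set (Plane F)} (hl : l ∈ exteriorLines F)
    (h1 : Algebra.trace (ZMod 2) F (1 : F) = 1) :
    ∃ g ∈ conicGroup F, g • l = affineLine 1 1 := by
  obtain ⟨x, y, h, rfl⟩ := exists_affineLine_of_mem_exteriorLines hl
  obtain ⟨a, b, c, d, p, r, hp, e1, e2⟩ := exists_isIsometryParam_to_one h h1
  obtain ⟨g, hg, he⟩ := hp.exists_smul_eq
  exact ⟨g, hg, by rw [he, e1, e2]⟩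

theorem one_mem_exteriorLines (h1 : Algebra.trace (ZMod 2) F (1 : F) = 1) :
    affineLine (1 : F) 1 ∈ exteriorLines F := by
  rw [affineLine_mem_exteriorLines, mul_one, h1]

/-- The group of the conic is transitive on each class. -/
theorem exists_smul_eq_of_mem_cls (hq : 4 ≤ Fintype.card F)
    (h1 : Algebra.trace (ZMod 2) F (1 : F) = 1) {q q' : Set (Plane F) × Set (Plane F)} {a : F}
    (ha : a ≠ 0) (h : q ∈ cls a) (h' : q' ∈ cls a) : ∃ g ∈ conicGroup F, g • q = q' := by
  have := charP_two F
  -- Each pair can be moved to one whose first line is `(1, 1, 1)^⊥`.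
  have key (q : Set (Plane F) × Set (Plane F)) (h : q ∈ cls a) : ∃ g ∈ conicGroup F, ∃ s t : F,
      g • q = (affineLine 1 1, affineLine (1 + s) (1 + t)) ∧ s ^ 2 + s * t + t ^ 2 = a := by
    obtain ⟨l, l'⟩ := q
    obtain ⟨g, hg, hl⟩ := exists_smul_eq_one h.1 h1
    have hm := smul_mem_cls hq hg h
    obtain ⟨z, u, -, hzu⟩ := exists_affineLine_of_mem_exteriorLines hm.2.1
    refine ⟨g, hg, z - 1, u - 1, ?_, ?_⟩
    · rw [add_sub_cancel, add_sub_cancel, ← hzu, ← hl]; rfl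
    · rw [Prod.smul_mk] at hm hzu
      simp only at hzu
      rw [hl, hzu, mem_cls_iff] at hm
      have := rho_add (1 : F) 1 (z - 1) (u - 1)
      rw [add_sub_cancel, add_sub_cancel, hm.2.2] at this
      rw [this]; ring
  obtain ⟨g, hg, s, t, e, hs⟩ := key q h
  obtain ⟨g', hg', s', t', e', hs'⟩ := key q' h'
  obtain ⟨a', b, c, d, p, r, hp, e1, e2, e3, e4⟩ := exists_isIsometryParam_fix_one
    (s := s) (t := t) (s' := s') (t' := t') (hs ▸ ha) (hs.trans hs'.symm)
  obtain ⟨k, hk, he⟩ := hp.exists_smul_eq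
  refine ⟨g'⁻¹ * (k * g), mul_mem (inv_mem hg') (mul_mem hk hg), ?_⟩
  rw [mul_smul, mul_smul, e, inv_smul_eq_iff, e', Prod.smul_mk, he, he]
  congr 2 <;> grind

theorem orbit_eq_cls (hq : 4 ≤ Fintype.card F) (h1 : Algebra.trace (ZMod 2) F (1 : F) = 1)
    {q : Set (Plane F) × Set (Plane F)} {a : F} (ha : a ≠ 0) (h : q ∈ cls a) :
    MulAction.orbit (conicGroup F) q = cls a := by
  ext q'
  constructor
  · rintro ⟨g, rfl⟩
    exact smul_mem_cls hq g.2 h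
  · intro h'
    obtain ⟨g, hg, e⟩ := exists_smul_eq_of_mem_cls hq h1 ha h h'
    exact ⟨⟨g, hg⟩, e⟩

theorem orbit_eq_diagCls (hq : 4 ≤ Fintype.card F) (h1 : Algebra.trace (ZMod 2) F (1 : F) = 1)
    {l : Set (Plane F)} (h : l ∈ exteriorLines F) :
    MulAction.orbit (conicGroup F) (l, l) = diagCls F := by
  ext ⟨k, k'⟩
  constructor
  · rintro ⟨g, hg⟩
    have hg' : (g.1 • l, g.1 • l) = (k, k') := hg
    obtain ⟨rfl, rfl⟩ := Prod.mk.inj hg'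
    refine ⟨?_, rfl⟩
    obtain ⟨x, y, -, rfl⟩ := exists_affineLine_of_mem_exteriorLines h
    obtain ⟨_, _, _, _, _, _, -, he⟩ := exists_isIsometryParam hq g.2
    simp only [he]
    exact smul_mem_exteriorLines g.2 (he x y) h
  · rintro ⟨hk, e⟩
    simp only at hk e
    subst e
    obtain ⟨g, hg, e⟩ := exists_smul_eq_one h h1
    obtain ⟨g', hg', e'⟩ := exists_smul_eq_one hk h1
    refine ⟨⟨g'⁻¹ * g, mul_mem (inv_mem hg') hg⟩, ?_⟩
    have : (g'⁻¹ * g) • l = k' := by rw [mul_smul, e, inv_smul_eq_iff, e']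
    exact Prod.ext this this

theorem cls_nonempty (h1 : Algebra.trace (ZMod 2) F (1 : F) = 1) {a : F} (ha : a ∈ T0star F) :
    (cls a).Nonempty := by
  have := charP_two F
  obtain ⟨s, rfl⟩ := (bijective_pow_two_pow (F := F) 1).2 a
  simp only [pow_one] at ha ⊢
  rw [mem_T0star, trace_sq] at ha
  refine ⟨(affineLine 1 1, affineLine (1 + s) (1 + 0)), mem_cls_iff.2
    ⟨one_mem_exteriorLines h1, ?_, by rw [rho_add]; ring⟩⟩
  rw [affineLine_mem_exteriorLines, add_zero, mul_one, map_add, h1, ha.1, add_zero]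

theorem orbitals_eq (hq : 4 ≤ Fintype.card F) (h1 : Algebra.trace (ZMod 2) F (1 : F) = 1) :
    orbitals F = insert (diagCls F) {R | ∃ a ∈ T0star F, R = cls a} := by
  ext R
  simp only [orbitals, Set.mem_ofPred_eq, Set.mem_insert_iff]
  constructor
  · rintro ⟨l, hl, l', hl', rfl⟩
    obtain ⟨x, y, hxy, rfl⟩ := exists_affineLine_of_mem_exteriorLines hl
    obtain ⟨z, u, hzu, rfl⟩ := exists_affineLine_of_mem_exteriorLines hl'
    by_cases h0 : rho x y z u = 0
    · obtain ⟨rfl, rfl⟩ := (rho_eq_zero_iff hxy).1 h0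
      exact Or.inl (orbit_eq_diagCls hq h1 hl)
    · refine Or.inr ⟨rho x y z u, mem_T0star.2 ⟨?_, h0⟩,
        orbit_eq_cls hq h1 h0 (mem_cls_iff.2 ⟨hl, hl', rfl⟩)⟩
      rw [trace_rho, hxy, hzu]; rfl
  · rintro (rfl | ⟨a, ha, rfl⟩)
    · have h := one_mem_exteriorLines h1
      exact ⟨_, h, _, h, (orbit_eq_diagCls hq h1 h).symm⟩
    · obtain ⟨⟨l, l'⟩, h⟩ := cls_nonempty h1 ha
      exact ⟨l, h.1, l', h.2.1, (orbit_eq_cls hq h1 (mem_T0star.1 ha).2 h).symm⟩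

/-- The lines in relation `a` to the first and in relation `b` to the second line of a pair. -/
def between (a b : F) (q : Set (Plane F) × Set (Plane F)) : Set (Set (Plane F)) :=
  {k | k ∈ exteriorLines F ∧ (q.1, k) ∈ cls a ∧ (k, q.2) ∈ cls b}

theorem ncard_between_eq (hq : 4 ≤ Fintype.card F) (h1 : Algebra.trace (ZMod 2) F (1 : F) = 1)
    {q q' : Set (Plane F) × Set (Plane F)} {a b c : F} (hc : c ≠ 0) (h : q ∈ cls c)
    (h' : q' ∈ cls c) : (between a b q).ncard = (between a b q').ncard := by
  obtain ⟨g, hg, rfl⟩ := exists_smul_eq_of_mem_cls hq h1 hc h h'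
  have : between a b (g • q) = g • between a b q := by
    ext k
    obtain ⟨k, rfl⟩ : ∃ k', k = g • k' := ⟨g⁻¹ • k, by simp⟩
    rw [Set.smul_mem_smul_set_iff]
    have e1 : ((g • q).1, g • k) = g • (q.1, k) := rfl
    have e2 : (g • k, (g • q).2) = g • (k, q.2) := rfl
    simp only [between, Set.mem_ofPred_eq, e1, e2, smul_mem_cls_iff hq hg]
    constructor
    · rintro ⟨_, h2, h3⟩; exact ⟨h3.1, h2, h3⟩
    · rintro ⟨_, h2, h3⟩; exact ⟨(smul_mem_cls hq hg h3).1, h2, h3⟩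
  rw [this, ← Set.image_smul, Set.ncard_image_of_injective _ (MulAction.injective g)]

open Classical in
/-- The intersection number `p^c_{a,b}`, read off from some pair of `Γ_c`. -/
noncomputable def interNum (a b c : F) : ℕ :=
  if h : (cls c).Nonempty then (between a b h.some).ncard else 0

theorem isIntersectionNumber_interNum (hq : 4 ≤ Fintype.card F)
    (h1 : Algebra.trace (ZMod 2) F (1 : F) = 1) (a b : F) {c : F} (hc : c ∈ T0star F) :
    IsIntersectionNumber a b c (interNum a b c) := by
  have hne := cls_nonempty h1 hc
  refine ⟨hne, fun q h => ?_⟩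
  rw [interNum, dif_pos hne]
  exact ncard_between_eq hq h1 (mem_T0star.1 hc).2 h hne.some_mem

end Orbitals

/-! ### The sum of intersection numbers -/

section Counting

open scoped Classical

variable {F : Type*} [Field F] [Algebra (ZMod 2) F]

theorem fibreCount_self (d s : F) : fibreCount d s s = 1 := if_pos rfl

theorem fibreCount_zero (s t : F) : fibreCount 0 s t = if s = t then 1 else 0 := by
  simp [fibreCount, chi_zero]

theorem fibreCount_one_zero {c : F} (hc : Algebra.trace (ZMod 2) F c = 0) :
    fibreCount c 1 0 = 0 := by
  simp [fibreCount, chi_of_trace_eq_zero hc]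

theorem div_add_ne_zero_ne_one {s t : F} (hs : s ≠ 0) (ht : t ≠ 0) (hst : s ≠ t) :
    ¬(s / (s + t) = 0 ∨ s / (s + t) = 1) := by
  have hst' : s + t ≠ 0 := fun h => hst (add_eq_zero_iff_eq_of_char_two.1 h)
  rintro (h | h)
  · exact hs ((div_eq_zero_iff.1 h).resolve_right hst')
  · rw [div_eq_one_iff_eq hst'] at h
    exact ht (by simpa using h)

variable [Fintype F]

theorem sum_rho_eq {s v : F} (hsv : Algebra.trace (ZMod 2) F (s * v) = 1) (t d : F) :
    ∑ u : F, (if rho s v t u = d then 1 else 0) = fibreCount d s t := by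
  rw [← card_rho_eq hsv, Finset.sum_boole]

theorem trace_eq_one_of_rho_mem {x y z u : F} (h : Algebra.trace (ZMod 2) F (x * y) = 1)
    (h0 : Algebra.trace (ZMod 2) F (rho x y z u) = 0) : Algebra.trace (ZMod 2) F (z * u) = 1 := by
  rw [trace_rho, h] at h0
  revert h0; generalize Algebra.trace (ZMod 2) F (z * u) = a; revert a; decide

/-- Intersection numbers in terms of coordinates. The sum may run over all `(s, v)`:
since `Tr a = 0`, the condition `ρ̂ = a` already makes `(1, s, v)^⊥` exterior. -/
theorem interNum_eq_sum (hq : 4 ≤ Fintype.card F) (h1 : Algebra.trace (ZMod 2) F (1 : F) = 1)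
    {a b x y z u : F} (ha : Algebra.trace (ZMod 2) F a = 0)
    (hxy : Algebra.trace (ZMod 2) F (x * y) = 1) (hc : rho x y z u ∈ T0star F) :
    (interNum a b (rho x y z u) : ℤ) =
      ∑ s : F, ∑ v : F,
        (if rho x y s v = a then 1 else 0) * (if rho s v z u = b then 1 else 0) := by
  have hzu := trace_eq_one_of_rho_mem hxy (mem_T0star.1 hc).1
  have hl := affineLine_mem_exteriorLines.2 hxy
  have hl' := affineLine_mem_exteriorLines.2 hzu
  have hinj : Function.Injective fun n : F × F => affineLine n.1 n.2 := fun n n' h =>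
    Prod.ext (affineLine_inj.1 h).1 (affineLine_inj.1 h).2
  have hbet : between a b (affineLine x y, affineLine z u) =
      (fun n : F × F => affineLine n.1 n.2) ''
      (Finset.univ.filter fun n : F × F => rho x y n.1 n.2 = a ∧ rho n.1 n.2 z u = b) := by
    ext k
    constructor
    · rintro ⟨hk, h2, h3⟩
      obtain ⟨s, v, -, rfl⟩ := exists_affineLine_of_mem_exteriorLines hk
      exact ⟨(s, v), by simpa using ⟨(mem_cls_iff.1 h2).2.2, (mem_cls_iff.1 h3).2.2⟩, rfl⟩
    · rintro ⟨⟨s, v⟩, h, rfl⟩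
      simp only [Finset.coe_filter, Finset.mem_univ, true_and, Set.mem_ofPred_eq] at h
      have hk : affineLine s v ∈ exteriorLines F := affineLine_mem_exteriorLines.2
        (trace_eq_one_of_rho_mem hxy (by rw [h.1, ha]))
      exact ⟨hk, mem_cls_iff.2 ⟨hl, hk, h.1⟩, mem_cls_iff.2 ⟨hk, hl', h.2⟩⟩
  rw [← (isIntersectionNumber_interNum hq h1 a b hc).2 _ (mem_cls_iff.2 ⟨hl, hl', rfl⟩)]
  change ((between a b (affineLine x y, affineLine z u)).ncard : ℤ) = _
  rw [hbet, Set.ncard_image_of_injective _ hinj, Set.ncard_coe_finset, ← Finset.sum_boole,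
    Fintype.sum_prod_type]
  refine Finset.sum_congr rfl fun s _ => Finset.sum_congr rfl fun v _ => ?_
  rw [ite_and, ite_mul, one_mul, zero_mul]

/-- The product of two classes, restricted to the sets of lines `(1, t, ·)^⊥` with given `t`,
is a product in the quotient by the relation of having the same first coordinate. -/
theorem sum_interNum_mul_fibreCount (hq : 4 ≤ Fintype.card F)
    (h1 : Algebra.trace (ZMod 2) F (1 : F) = 1) {a d : F} (ha : a ∈ T0star F) (hd : d ∈ T0star F)
    (had : a ≠ d) (t : F) :
    ∑ b ∈ T0star F, interNum a d b * fibreCount b 1 t =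
      ∑ s : F, fibreCount a 1 s * fibreCount d s t := by
  have h11 : Algebra.trace (ZMod 2) F ((1 : F) * 1) = 1 := by rw [mul_one, h1]
  rw [mem_T0star] at ha hd
  set N : F → ℤ := fun u => ∑ s : F, ∑ v : F,
    (if rho 1 1 s v = a then 1 else 0) * (if rho s v t u = d then 1 else 0) with hN
  -- A path ending at `(1, t, u)^⊥` forces that line to be exterior, and different from
  -- `(1, 1, 1)^⊥` because `a ≠ d`.
  have hN0 (u : F) (hu : rho 1 1 t u ∉ T0star F) : N u = 0 := by
    refine Finset.sum_eq_zero fun s _ => Finset.sum_eq_zero fun v _ => ?_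
    rw [ite_zero_mul_ite_zero, if_neg]
    rintro ⟨e1, e2⟩
    have hsv := trace_eq_one_of_rho_mem h11 (by rw [e1, ha.1])
    have htu := trace_eq_one_of_rho_mem hsv (by rw [e2, hd.1])
    refine hu (mem_T0star.2 ⟨by rw [trace_rho, h11, htu]; rfl, fun h0 => had ?_⟩)
    obtain ⟨rfl, rfl⟩ := (rho_eq_zero_iff h11).1 h0
    rw [← e1, ← e2]
    unfold rho
    ring
  calc ∑ b ∈ T0star F, interNum a d b * fibreCount b 1 t
      = ∑ b ∈ T0star F, ∑ u : F, if rho 1 1 t u = b then N u else 0 := by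
        refine Finset.sum_congr rfl fun b hb => ?_
        rw [← sum_rho_eq h11, Finset.mul_sum]
        refine Finset.sum_congr rfl fun u _ => ?_
        split_ifs with h
        · subst h
          rw [mul_one, interNum_eq_sum hq h1 ha.1 h11 hb]
        · rw [mul_zero]
    _ = ∑ u : F, N u := by
        rw [Finset.sum_comm]
        refine Finset.sum_congr rfl fun u _ => ?_
        rw [Finset.sum_ite_eq]
        split_ifs with h
        · rfl
        · rw [hN0 u h]
    _ = ∑ s : F, fibreCount a 1 s * fibreCount d s t := by
        rw [hN, Finset.sum_comm]
        refine Finset.sum_congr rfl fun s _ => ?_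
        rw [Finset.sum_comm, ← sum_rho_eq h11, Finset.sum_mul]
        refine Finset.sum_congr rfl fun v _ => ?_
        rw [← Finset.mul_sum]
        by_cases h : rho 1 1 s v = a
        · rw [sum_rho_eq (trace_eq_one_of_rho_mem h11 (by rw [h, ha.1]))]
        · rw [if_neg h, zero_mul, zero_mul]

/-- As `Tr` is invariant under squaring, the argument `s² d / (s + t)²` of `chi` in `fibreCount`
can be replaced by its square root. -/
theorem fibreCount_sq {s t : F} (hst : s ≠ t) (c : F) :
    fibreCount (c ^ 2) s t = 1 - chi (c * (s / (s + t))) := by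
  rw [fibreCount, if_neg hst, ← chi_sq (c * (s / (s + t)))]
  congr 2
  rw [mul_pow, div_pow, ← mul_div_assoc, mul_comm]

theorem sum_T0_pow_two_pow (f : F → ℤ) (k : ℕ) : ∑ c ∈ T0 F, f (c ^ 2 ^ k) = ∑ c ∈ T0 F, f c := by
  simp only [T0, Finset.sum_filter]
  rw [← (bijective_pow_two_pow (F := F) k).sum_comp
    fun c => if Algebra.trace (ZMod 2) F c = 0 then f c else 0]
  simp only [trace_pow_two_pow]

theorem two_mul_sum_T0_fibreCount {s t : F} (hs : s ≠ 0) (ht : t ≠ 0) :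
    2 * ∑ c ∈ T0 F, fibreCount c s t = Fintype.card F := by
  by_cases hst : s = t
  · simp [fibreCount, hst, two_mul_card_T0]
  · rw [← sum_T0_pow_two_pow _ 1]
    simp only [pow_one, fibreCount_sq hst, Finset.sum_sub_distrib, mul_sub, two_mul_sum_T0_chi,
      if_neg (div_add_ne_zero_ne_one hs ht hst)]
    simp [two_mul_card_T0]

/-- For `s ∉ {1, t}` the product expands into characters of `c`, of which only the product term
can be trivial on the elements of trace `0`; for `s ∈ {1, t}` one factor is constant. -/
theorem two_mul_sum_T0_fibreCount_mul (k : ℕ) {s t : F} (hs : s ≠ 0) (ht : t ≠ 0) :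
    2 * ∑ c ∈ T0 F, fibreCount c 1 s * fibreCount (c ^ 2 ^ k) s t = Fintype.card F +
      if s ≠ 1 ∧ s ≠ t ∧ (s ^ 2 ^ k * s = t ∨ s ^ 2 ^ k * t = s) then (Fintype.card F : ℤ)
        else 0 := by
  have := charP_two F
  by_cases h1 : s = 1
  · subst h1
    rw [if_neg (by simp), add_zero, ← two_mul_sum_T0_fibreCount one_ne_zero ht,
      ← sum_T0_pow_two_pow (fun c => fibreCount c 1 t) k]
    simp only [fibreCount_self, one_mul]
  by_cases hst : s = t
  · subst hst
    rw [if_neg (by simp), add_zero, ← two_mul_sum_T0_fibreCount one_ne_zero ht]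
    congr 1
    refine Finset.sum_congr rfl fun c _ => ?_
    rw [fibreCount_self, mul_one]
  have h1' : (1 : F) ≠ s := Ne.symm h1
  have hst' : s + t ≠ 0 := fun h => hst (add_eq_zero_iff_eq_of_char_two.1 h)
  have hw : s ^ 2 ^ k ≠ 1 := fun h =>
    h1 ((bijective_pow_two_pow (F := F) k).1 (by simpa using h))
  have hw' : 1 + s ^ 2 ^ k ≠ 0 := fun h => hw (add_eq_zero_iff_eq_of_char_two.1 h).symm
  obtain ⟨τ, hτ⟩ : ∃ τ, τ = 1 / (1 + s ^ 2 ^ k) + s / (s + t) := ⟨_, rfl⟩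
  -- The substitution of `c²` for `c` removes the square roots from the arguments of `chi`.
  have hprod (c : F) : fibreCount (c ^ 2) 1 s * fibreCount ((c ^ 2) ^ 2 ^ k) s t =
      1 - chi (c * (1 / (1 + s))) - chi (c ^ 2 ^ k * (s / (s + t))) + chi (c ^ 2 ^ k * τ) := by
    rw [pow_right_comm c 2, fibreCount_sq h1', fibreCount_sq hst, hτ, mul_add, chi_add,
      ← chi_pow_two_pow (c * (1 / (1 + s))) k, mul_pow, div_pow, add_pow_two_pow, one_pow]
    ring
  have hcond : (τ = 0 ∨ τ = 1) ↔ (s ^ 2 ^ k * s = t ∨ s ^ 2 ^ k * t = s) := by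
    rw [hτ]
    generalize s ^ 2 ^ k = w at *
    refine or_congr ?_ ?_
    · field_simp
      grind
    · field_simp
      grind
  rw [← sum_T0_pow_two_pow _ 1]
  simp only [pow_one, hprod, Finset.sum_add_distrib, Finset.sum_sub_distrib]
  rw [sum_T0_pow_two_pow (fun c => chi (c * (s / (s + t)))) k,
    sum_T0_pow_two_pow (fun c => chi (c * τ)) k]
  have e1 := two_mul_sum_T0_chi (1 / (1 + s))
  have e2 := two_mul_sum_T0_chi (s / (s + t))
  have e3 := two_mul_sum_T0_chi τ
  rw [if_neg (div_add_ne_zero_ne_one one_ne_zero hs h1')] at e1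
  rw [if_neg (div_add_ne_zero_ne_one hs ht hst)] at e2
  simp only [hcond] at e3
  have e4 := two_mul_card_T0 (F := F)
  simp only [Finset.sum_const, nsmul_eq_mul, mul_one, ne_eq, h1, hst, not_false_eq_true, true_and]
  linarith

theorem exists_pow_eq_iff {F : Type*} [Field F] [Fintype F] {n : ℕ}
    (hn : (Fintype.card F - 1).Coprime n) {t : F} (ht : t ≠ 0) :
    ∃ s₀ : F, s₀ ≠ 0 ∧ ∀ s, s ≠ 0 → (s ^ n = t ↔ s = s₀) := by
  have hc : (Nat.card Fˣ).Coprime n := by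
    rwa [Nat.card_units, Nat.card_eq_fintype_card]
  obtain ⟨s₀, hs₀⟩ := (powCoprime hc).surjective (Units.mk0 t ht)
  refine ⟨s₀, s₀.ne_zero, fun s hs => ?_⟩
  have := (powCoprime hc).injective.eq_iff' (a := Units.mk0 s hs) hs₀
  simpa [Units.ext_iff] using this

/-- The solutions are the roots of `s ^ (2 ^ k + 1) = t` and of `s ^ (2 ^ k - 1) = t⁻¹`. For `t = 1`
both are the excluded `s = 1`; otherwise they differ, as `s ^ 2 ^ (k + 1) = 1` only for `s = 1`. -/
theorem card_exceptional {k : ℕ} (hp : (Fintype.card F - 1).Coprime (2 ^ k + 1))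
    (hm : (Fintype.card F - 1).Coprime (2 ^ k - 1)) {t : F} (ht : t ≠ 0) :
    (Finset.univ.filter fun s : F => s ≠ 0 ∧ s ≠ 1 ∧ s ≠ t ∧
      (s ^ 2 ^ k * s = t ∨ s ^ 2 ^ k * t = s)).card = if t = 1 then 0 else 2 := by
  have h2k : 2 ^ k - 1 + 1 = 2 ^ k := Nat.sub_add_cancel Nat.one_le_two_pow
  obtain ⟨a, ha, ha'⟩ := exists_pow_eq_iff hp ht
  obtain ⟨b, hb, hb'⟩ := exists_pow_eq_iff hm (inv_ne_zero ht)
  have hb'' (s : F) (hs : s ≠ 0) : s ^ 2 ^ k * t = s ↔ s = b := by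
    have e : s ^ 2 ^ k = s ^ (2 ^ k - 1) * s := by rw [← pow_succ, h2k]
    rw [← hb' s hs, e, ← mul_eq_one_iff_eq_inv₀ ht]
    constructor
    · intro h
      apply mul_right_cancel₀ hs
      linear_combination h
    · intro h
      linear_combination s * h
  have hinj {s : F} (h : s ^ 2 ^ k = 1) : s = 1 :=
    (bijective_pow_two_pow (F := F) k).1 (by simpa using h)
  have hcond (s : F) (hs : s ≠ 0) : (s ^ 2 ^ k * s = t ∨ s ^ 2 ^ k * t = s) ↔ (s = a ∨ s = b) := by
    rw [hb'' s hs, ← pow_succ, ha' s hs]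
  have ea := (ha' a ha).2 rfl
  have eb := (hb'' b hb).2 rfl
  rw [pow_succ] at ea
  split_ifs with h1
  · subst h1
    have a1 : 1 = a := (ha' 1 one_ne_zero).1 (one_pow _)
    have b1 : 1 = b := (hb' 1 one_ne_zero).1 (by simp)
    rw [Finset.card_eq_zero, Finset.filter_eq_empty_iff]
    rintro s - ⟨hs, hs1, -, h⟩
    rw [hcond s hs, ← a1, ← b1, or_self] at h
    exact hs1 h
  · have hab : a ≠ b := by
      rintro rfl
      apply h1
      have : (a ^ 2 ^ k) ^ 2 = 1 := by
        apply mul_right_cancel₀ ha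
        rw [← ea] at eb
        linear_combination eb
      have : a = 1 := hinj (by
        apply (bijective_pow_two_pow (F := F) 1).1
        simpa using this)
      rw [← ea, this]; simp
    have hset : (Finset.univ.filter fun s : F => s ≠ 0 ∧ s ≠ 1 ∧ s ≠ t ∧
        (s ^ 2 ^ k * s = t ∨ s ^ 2 ^ k * t = s)) = {a, b} := by
      ext s
      simp only [Finset.mem_filter, Finset.mem_univ, true_and, Finset.mem_insert,
        Finset.mem_singleton]
      constructor
      · rintro ⟨hs, -, -, h⟩
        exact (hcond s hs).1 h
      · rintro (rfl | rfl)
        · refine ⟨ha, ?_, ?_, Or.inl ea⟩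
          · rintro rfl; exact h1 (by simpa using ea.symm)
          · rintro rfl; exact h1 (hinj (mul_right_cancel₀ ha (by rw [ea, one_mul])))
        · refine ⟨hb, ?_, ?_, Or.inr eb⟩
          · rintro rfl; exact h1 (by simpa using eb)
          · rintro rfl; exact h1 (hinj (mul_right_cancel₀ hb (by rw [eb, one_mul])))
    rw [hset, Finset.card_pair hab]

/-- The linear equations satisfied by the numbers `∑ c, p^b_{c, c^σ}` have the constant `q + 1`
as a solution. The term `c = 0`, which completes both sums to the elements of trace `0`,
contributes only for `t = 1`. -/
theorem sum_fibreCount_mul {k : ℕ} (hp : (Fintype.card F - 1).Coprime (2 ^ k + 1))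
    (hm : (Fintype.card F - 1).Coprime (2 ^ k - 1)) {t : F} (ht : t ≠ 0) :
    ∑ c ∈ T0star F, ∑ s : F, fibreCount c 1 s * fibreCount (c ^ 2 ^ k) s t =
      (Fintype.card F + 1) * ∑ c ∈ T0star F, fibreCount c 1 t := by
  have hk : (0 : F) ^ 2 ^ k = 0 := zero_pow (by positivity)
  have e1 := sum_T0 fun c : F => ∑ s : F, fibreCount c 1 s * fibreCount (c ^ 2 ^ k) s t
  have e2 := sum_T0 fun c : F => fibreCount c 1 t
  have e3 := two_mul_sum_T0_fibreCount (F := F) one_ne_zero ht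
  simp only [hk, fibreCount_zero, ite_mul, one_mul, zero_mul, Finset.sum_ite_eq,
    Finset.mem_univ, if_true] at e1 e2
  have e4 : 2 * ∑ c ∈ T0 F, ∑ s : F, fibreCount c 1 s * fibreCount (c ^ 2 ^ k) s t =
      Fintype.card F * (Fintype.card F - 1) +
        Fintype.card F * if t = 1 then 0 else 2 := by
    rw [Finset.sum_comm, Finset.mul_sum]
    have h (s : F) : 2 * ∑ c ∈ T0 F, fibreCount c 1 s * fibreCount (c ^ 2 ^ k) s t =
        (Fintype.card F - if s = 0 then (Fintype.card F : ℤ) else 0) + Fintype.card F *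
          if s ≠ 0 ∧ s ≠ 1 ∧ s ≠ t ∧ (s ^ 2 ^ k * s = t ∨ s ^ 2 ^ k * t = s) then 1 else 0 := by
      by_cases hs : s = 0
      · subst hs
        rw [Finset.sum_eq_zero]
        · simp
        · intro c hc
          rw [fibreCount_one_zero (mem_T0.1 hc), zero_mul]
      · rw [two_mul_sum_T0_fibreCount_mul k hs ht]
        simp [hs]
    simp only [h, Finset.sum_add_distrib, Finset.sum_sub_distrib, ← Finset.mul_sum]
    rw [Finset.sum_boole, card_exceptional hp hm ht]
    simp
    ring
  by_cases h : t = 1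
  · subst h
    simp only [if_true] at e1 e2 e4
    nlinarith
  · rw [if_neg (Ne.symm h)] at e1 e2
    rw [if_neg h] at e4
    nlinarith

/-- The functions `t ↦ fibreCount b 1 t` for `b` nonzero of trace `0` are linearly independent,
by Fourier inversion. -/
theorem eq_zero_of_sum_mul_fibreCount {h : F → ℤ}
    (hh : ∀ t : F, t ≠ 0 → ∑ b ∈ T0star F, h b * fibreCount b 1 t = 0) {b₀ : F}
    (hb₀ : b₀ ∈ T0star F) : h b₀ = 0 := by
  have := charP_two F
  have hsum : ∑ b ∈ T0star F, h b = 0 := by simpa [fibreCount] using hh 1 one_ne_zero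
  have hfour (w : F) : ∑ b ∈ T0star F, h b * chi (b * w) = 0 := by
    by_cases hw : w = 0 ∨ w = 1
    · rw [← hsum]
      refine Finset.sum_congr rfl fun b hb => ?_
      rcases hw with rfl | rfl
      · rw [mul_zero, chi_zero, mul_one]
      · rw [mul_one, chi_of_trace_eq_zero (mem_T0star.1 hb).1, mul_one]
    · obtain ⟨v, rfl⟩ := (bijective_pow_two_pow (F := F) 1).2 w
      simp only [pow_one] at hw ⊢
      have hv0 : v ≠ 0 := by rintro rfl; simp at hw
      have hv1 : v ≠ 1 := by rintro rfl; simp at hw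
      have hne : (1 : F) ≠ 1 + 1 / v := by simp [hv0]
      have ht : (1 : F) + 1 / v ≠ 0 := by
        rw [Ne, add_eq_zero_iff_eq_of_char_two]
        field_simp
        exact hv1
      have hfib (b : F) : fibreCount b 1 (1 + 1 / v) = 1 - chi (b * v ^ 2) := by
        rw [fibreCount, if_neg hne]
        congr 2
        rw [← add_assoc, CharTwo.add_self_eq_zero]
        field_simp
        simp
      have := hh _ ht
      simp only [hfib, mul_sub, mul_one, Finset.sum_sub_distrib, hsum] at this
      linarith
  have hq : (Fintype.card F : ℤ) ≠ 0 := by exact_mod_cast Fintype.card_ne_zero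
  have key : ∑ w : F, chi (b₀ * w) * ∑ b ∈ T0star F, h b * chi (b * w) = Fintype.card F * h b₀ := by
    simp only [Finset.mul_sum]
    rw [Finset.sum_comm]
    have (b : F) : ∑ w : F, chi (b₀ * w) * (h b * chi (b * w)) =
        if b₀ = b then Fintype.card F * h b else 0 := by
      have : ∀ w : F, chi (b₀ * w) * (h b * chi (b * w)) = h b * chi ((b₀ + b) * w) := by
        intro w
        rw [add_mul, chi_add]; ring
      simp only [this, ← Finset.mul_sum, sum_chi_mul, add_eq_zero_iff_eq_of_char_two]
      split_ifs <;> ring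
    simp only [this, Finset.sum_ite_eq, if_pos hb₀]
  simp only [hfour, mul_zero, Finset.sum_const_zero] at key
  exact (mul_eq_zero.1 key.symm).resolve_left hq

theorem trace_one {m : ℕ} (hF : Fintype.card F = 2 ^ m) (hm : Odd m) :
    Algebra.trace (ZMod 2) F (1 : F) = 1 := by
  have h : Module.finrank (ZMod 2) F = m := by
    have := Module.card_eq_pow_finrank (K := ZMod 2) (V := F)
    rw [ZMod.card, hF] at this
    exact (Nat.pow_right_injective le_rfl this).symm
  have := Algebra.trace_algebraMap (R := ZMod 2) (S := F) 1
  rw [map_one, h, nsmul_eq_mul, mul_one] at this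
  rw [this]
  exact (ZMod.natCast_eq_one_iff_odd).2 hm

theorem sum_interNum {k : ℕ} (hq : 4 ≤ Fintype.card F)
    (h1 : Algebra.trace (ZMod 2) F (1 : F) = 1)
    (hp : (Fintype.card F - 1).Coprime (2 ^ k + 1)) (hm : (Fintype.card F - 1).Coprime (2 ^ k - 1))
    {b : F} (hb : b ∈ T0star F) :
    ∑ c ∈ T0star F, interNum c (c ^ 2 ^ k) b = Fintype.card F + 1 := by
  have hpow (c : F) (hc : c ∈ T0star F) : c ^ 2 ^ k ∈ T0star F ∧ c ≠ c ^ 2 ^ k := by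
    rw [mem_T0star] at hc ⊢
    refine ⟨⟨by rw [trace_pow_two_pow, hc.1], pow_ne_zero _ hc.2⟩, fun h => ?_⟩
    obtain ⟨s, -, hs⟩ := exists_pow_eq_iff (F := F) hm one_ne_zero
    have hc1 : c ^ (2 ^ k - 1) = 1 := by
      apply mul_right_cancel₀ hc.2
      rw [← pow_succ, Nat.sub_add_cancel Nat.one_le_two_pow, one_mul, ← h]
    have : c = 1 := ((hs c hc.2).1 hc1).trans ((hs 1 one_ne_zero).1 (one_pow _)).symm
    rw [this, h1] at hc
    exact one_ne_zero hc.1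
  have key := eq_zero_of_sum_mul_fibreCount
    (h := fun b => (∑ c ∈ T0star F, (interNum c (c ^ 2 ^ k) b : ℤ)) - (Fintype.card F + 1))
    (fun t ht => ?_) hb
  · simp only [sub_eq_zero] at key
    exact_mod_cast key
  · simp only [sub_mul, Finset.sum_sub_distrib, ← Finset.mul_sum]
    rw [← sum_fibreCount_mul hp hm ht, sub_eq_zero]
    simp only [Finset.sum_mul]
    rw [Finset.sum_comm]
    refine Finset.sum_congr rfl fun c hc => ?_
    exact sum_interNum_mul_fibreCount hq h1 hc (hpow c hc).1 (hpow c hc).2 t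

end Counting

theorem coprime_two_pow_sub_one {m k : ℕ} (h : m.Coprime k) : (2 ^ m - 1).Coprime (2 ^ k - 1) := by
  rw [Nat.Coprime, Nat.pow_sub_one_gcd_pow_sub_one, h]; rfl

theorem coprime_two_pow_add_one {m k : ℕ} (hm : Odd m) (h : m.Coprime k) :
    (2 ^ m - 1).Coprime (2 ^ k + 1) := by
  have h2 : m.Coprime (k * 2) := Nat.Coprime.mul_right h (Nat.coprime_two_right.2 hm)
  refine Nat.Coprime.coprime_dvd_right ⟨2 ^ k - 1, ?_⟩ (coprime_two_pow_sub_one h2)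
  rw [pow_mul, ← Nat.sq_sub_sq, one_pow]

end EllipticScheme

theorem mainTheorem2 {F : Type*} [Field F] [Fintype F] [Algebra (ZMod 2) F] (m k : ℕ)
    (hF : Fintype.card F = 2 ^ m) (hm : Odd m) (hk : 1 ≤ k) (hkm : k ≤ m - 1)
    (hgcd : Nat.gcd k m = 1) :
    EllipticScheme.orbitals F = insert (EllipticScheme.diagCls F)
      {R | ∃ a ∈ EllipticScheme.T0star F, R = EllipticScheme.cls a} ∧
    ∃ p : F → F → F → ℕ,
      (∀ a ∈ EllipticScheme.T0star F, ∀ b ∈ EllipticScheme.T0star F,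
        ∀ c ∈ EllipticScheme.T0star F, EllipticScheme.IsIntersectionNumber a b c (p a b c)) ∧
      ∀ b ∈ EllipticScheme.T0star F,
        ∑ c ∈ EllipticScheme.T0star F, p c (c ^ (2 ^ k)) b = 2 ^ m + 1 := by
  have h1 := EllipticScheme.trace_one hF hm
  have hq : 4 ≤ Fintype.card F := by
    rw [hF]
    exact Nat.pow_le_pow_right (n := 2) two_pos (show 2 ≤ m by omega)
  have hc : m.Coprime k := Nat.Coprime.symm hgcd
  refine ⟨EllipticScheme.orbitals_eq hq h1, EllipticScheme.interNum, fun a _ b _ c hc =>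
    EllipticScheme.isIntersectionNumber_interNum hq h1 a b hc, fun b hb => ?_⟩
  rw [EllipticScheme.sum_interNum hq h1 ?_ ?_ hb, hF]
  · rw [hF]; exact EllipticScheme.coprime_two_pow_add_one hm hc
  · rw [hF]; exact EllipticScheme.coprime_two_pow_sub_one hc
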